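/- Let $n\ge 1$ and let $\mathfrak S_n$ be the set of permutations $\sigma=\sigma(1)\cdots\sigma(n)$ of $\{1,\dots,n\}$. With the boundary convention $\sigma(0)=\sigma(n+1)=0$, an entry $\sigma(i)$ ($1\le i\le n$) is a *valley* if $\sigma(i-1)>\sigma(i)<\sigma(i+1)$, a *double ascent* if $\sigma(i-1)<\sigma(i)<\sigma(i+1)$, and a *double descent* if $\sigma(i-1)>\sigma(i)>\sigma(i+1)$; let $\mathrm{valley}^*\sigma$, $\mathrm{da}^*\sigma$, $\mathrm{dd}^*\sigma$ be the numbers of these. Let $\mathrm{des}\,\sigma$ be the number of $i$ with $1\le i<n$ and $\sigma(i)>\sigma(i+1)$, let $\mathrm{les}\,\sigma$ be the number of pairs $2\le i<j\le n$ with $\sigma(i-1)>\sigma(j)>\sigma(i)$, and let $\mathrm{res}\,\sigma$ be the number of pairs $1\le i<j\le n-1$ with $\sigma(j+1)>\sigma(i)>\sigma(j)$. Put $$A_n(p,q,t,u,v,w)=\sum_{\sigma\in\mathfrak S_n}p^{\mathrm{res}\,\sigma}q^{\mathrm{les}\,\sigma}t^{\mathrm{des}\,\sigma}u^{\mathrm{da}^*\sigma}v^{\mathrm{dd}^*\sigma}w^{\mathrm{valley}^*\sigma}\in\mathbb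 Z[p,q,t,u,v,w],$$ $$a_{n,k}(p,q)=\sum_{\sigma}p^{\mathrm{res}\,\sigma}q^{\mathrm{les}\,\sigma}\in\mathbb Z[p,q],$$ the last sum running over all $\sigma\in\mathfrak S_n$ with $\mathrm{valley}^*\sigma=k$ and $\mathrm{dd}^*\sigma=0$. Then $$A_n(p,q,t,u,v,w)=\sum_{k=0}^{\lfloor (n-1)/2\rfloor}a_{n,k}(p,q)\,(tw)^k\,(u+vt)^{n-1-2k},$$ and $(p+q)^k$ divides $a_{n,k}(p,q)$ in $\mathbb Z[p,q]$ for all $0\le k\le\lfloor (n-1)/2\rfloor$. Moreover, for all $0\le k\le\lfloor (n-1)/2\rfloor$, $$2^{n-1-2k}\,a_{n,k}(p,q)=\sum_{\sigma}p^{(13\text{-}2)\sigma}q^{(2\text{-}31)\sigma},$$ where the sum runs over the $\sigma\in\mathfrak S_n$ with exactly $k$ peaks ($\sigma(i-1)<\sigma(i)>\sigma(i+1)$, $1\le i\le n$) for the convention $\sigma(0)=\sigma(n+1)=n+1$, $(13\text{-}2)\sigma$ is the number of pairs $2\le i<j\le n$ with $\sigma(i-1)<\sigma(j)<\sigma(i)$,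 and $(2\text{-}31)\sigma$ is the number of pairs $1\le i<j\le n-1$ with $\sigma(j+1)<\sigma(i)<\sigma(j)$. Hence the divisibility above is Brändén's conjecture that $(p+q)^k$ divides $2^{-n+1+2k}\sum_{\sigma}p^{(13\text{-}2)\sigma}q^{(2\text{-}31)\sigma}$. -/

import Mathlib

/-!
Permutations of `[n] = {1, …, n}` are represented by `Equiv.Perm (Fin n)`; the one-line notation
`σ(1) … σ(n)` with 1-based positions and values, together with the boundary values `σ(0)` and
`σ(n+1)`, is given by `PermStat.word`.
-/

namespace PermStat

open MvPolynomial

/-- The one-line notation of `σ` with boundary value `b`: for `1 ≤ i ≤ n` it is the (1-based)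
value `σ(i) ∈ {1, …, n}`, and it is `b` at every other position, in particular at `0`, `n + 1`. -/
def word {n : ℕ} (b : ℕ) (σ : Equiv.Perm (Fin n)) (i : ℕ) : ℕ :=
  if h : 1 ≤ i ∧ i ≤ n then (σ ⟨i - 1, by omega⟩ : ℕ) + 1 else b

/-- The number of descents: `1 ≤ i < n` with `σ(i) > σ(i+1)`. -/
def des {n : ℕ} (σ : Equiv.Perm (Fin n)) : ℕ :=
  ((Finset.Icc 1 n).filter fun i => i < n ∧ word 0 σ i > word 0 σ (i + 1)).card

/-- The number of peaks, for the convention `σ(0) = σ(n+1) = b`. -/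
def peak {n : ℕ} (b : ℕ) (σ : Equiv.Perm (Fin n)) : ℕ :=
  ((Finset.Icc 1 n).filter fun i =>
    word b σ (i - 1) < word b σ i ∧ word b σ i > word b σ (i + 1)).card

/-- The number of valleys, for the convention `σ(0) = σ(n+1) = b`. -/
def valley {n : ℕ} (b : ℕ) (σ : Equiv.Perm (Fin n)) : ℕ :=
  ((Finset.Icc 1 n).filter fun i =>
    word b σ (i - 1) > word b σ i ∧ word b σ i < word b σ (i + 1)).card

/-- The number of double ascents, for the convention `σ(0) = σ(n+1) = b`. -/
def doubleAscent {n : ℕ} (b : ℕ) (σ : Equiv.Perm (Fin n)) : ℕ :=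
  ((Finset.Icc 1 n).filter fun i =>
    word b σ (i - 1) < word b σ i ∧ word b σ i < word b σ (i + 1)).card

/-- The number of double descents, for the convention `σ(0) = σ(n+1) = b`. -/
def doubleDescent {n : ℕ} (b : ℕ) (σ : Equiv.Perm (Fin n)) : ℕ :=
  ((Finset.Icc 1 n).filter fun i =>
    word b σ (i - 1) > word b σ i ∧ word b σ i > word b σ (i + 1)).card

/-- The number of pairs `2 ≤ i < j ≤ n` with `σ(i-1) > σ(j) > σ(i)` (pattern 31-2). -/
def les {n : ℕ} (σ : Equiv.Perm (Fin n)) : ℕ :=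
  ((Finset.Icc 1 n ×ˢ Finset.Icc 1 n).filter fun x =>
    2 ≤ x.1 ∧ x.1 < x.2 ∧ x.2 ≤ n ∧
      word 0 σ (x.1 - 1) > word 0 σ x.2 ∧ word 0 σ x.2 > word 0 σ x.1).card

/-- The number of pairs `1 ≤ i < j ≤ n - 1` with `σ(j+1) > σ(i) > σ(j)` (pattern 2-13). -/
def res {n : ℕ} (σ : Equiv.Perm (Fin n)) : ℕ :=
  ((Finset.Icc 1 n ×ˢ Finset.Icc 1 n).filter fun x =>
    1 ≤ x.1 ∧ x.1 < x.2 ∧ x.2 + 1 ≤ n ∧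
      word 0 σ (x.2 + 1) > word 0 σ x.1 ∧ word 0 σ x.1 > word 0 σ x.2).card

/-- The number of pairs `2 ≤ i < j ≤ n` with `σ(i-1) < σ(j) < σ(i)` (pattern 13-2). -/
def pat13_2 {n : ℕ} (σ : Equiv.Perm (Fin n)) : ℕ :=
  ((Finset.Icc 1 n ×ˢ Finset.Icc 1 n).filter fun x =>
    2 ≤ x.1 ∧ x.1 < x.2 ∧ x.2 ≤ n ∧
      word 0 σ (x.1 - 1) < word 0 σ x.2 ∧ word 0 σ x.2 < word 0 σ x.1).card

/-- The number of pairs `1 ≤ i < j ≤ n - 1` with `σ(j+1) < σ(i) < σ(j)` (pattern 2-31). -/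
def pat2_31 {n : ℕ} (σ : Equiv.Perm (Fin n)) : ℕ :=
  ((Finset.Icc 1 n ×ˢ Finset.Icc 1 n).filter fun x =>
    1 ≤ x.1 ∧ x.1 < x.2 ∧ x.2 + 1 ≤ n ∧
      word 0 σ (x.2 + 1) < word 0 σ x.1 ∧ word 0 σ x.1 < word 0 σ x.2).card

/-- The generalized Eulerian polynomial `A_n(p,q,t,u,v,w)` in `ℤ[p,q,t,u,v,w]`; the variables
`p, q, t, u, v, w` are `X 0, …, X 5` in this order. The boundary convention is
`σ(0) = σ(n+1) = 0`. -/
noncomputable def genEulerian (n : ℕ) : MvPolynomial (Fin 6) ℤ :=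
  ∑ σ : Equiv.Perm (Fin n),
    X 0 ^ res σ * X 1 ^ les σ * X 2 ^ des σ *
      X 3 ^ doubleAscent 0 σ * X 4 ^ doubleDescent 0 σ * X 5 ^ valley 0 σ

/-- The set of permutations with exactly `k` valleys and without double descents, for the
convention `σ(0) = σ(n+1) = 0`. -/
def permsValley (n k : ℕ) : Finset (Equiv.Perm (Fin n)) :=
  Finset.univ.filter fun σ => valley 0 σ = k ∧ doubleDescent 0 σ = 0

/-- The polynomial `a_{n,k}(p,q)` in `ℤ[p,q]`, with `p = X 0` and `q = X 1`. -/
noncomputable def gammaCoeff (n k : ℕ) : MvPolynomial (Fin 2) ℤ :=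
  ∑ σ ∈ permsValley n k, X 0 ^ res σ * X 1 ^ les σ

/-- The generating polynomial in `ℤ[p,q]` of the patterns 13-2 and 2-31 over the permutations with
exactly `k` peaks, for the convention `σ(0) = σ(n+1) = n + 1`. -/
noncomputable def peakSum (n k : ℕ) : MvPolynomial (Fin 2) ℤ :=
  ∑ σ ∈ (Finset.univ : Finset (Equiv.Perm (Fin n))).filter (fun σ => peak (n + 1) σ = k),
    X 0 ^ pat13_2 σ * X 1 ^ pat2_31 σ

/-- The inclusion `ℤ[p,q] ⊆ ℤ[p,q,t,u,v,w]`. -/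
noncomputable def inclPQ : MvPolynomial (Fin 2) ℤ →ₐ[ℤ] MvPolynomial (Fin 6) ℤ :=
  rename (Fin.castLE (by decide))

end PermStat

/-!
Remove the letters of a permutation one by one, the smallest first. The letters already removed
matter only as cuts between the remaining pieces, that is, as bars that are smaller than every
letter. Removing the smallest letter merges the two gaps around it into one gap with a bar, so the
number of bars changes by `1`, `0`, `0`, `-1` according as this letter was a valley, a double
ascent, a double descent or a peak. Conversely, the choice of the place where the letter is put back
contributes the `(p,q)`-analogue of one less than the resulting number of bars to the weight. This
is the recursion of weighted Motzkin paths from height `1` that stop on reaching height `0`, in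
which double ascents and double descents both give level steps; hence the powers of `u + vt`.

Every up step of such a path is matched with a down step between the same two heights, one of these
two steps starts at an even height, and the `(p,q)`-analogue of an even number is divisible by
`p + q`. The last identity compares the weights `u = v = 1` and `u = 1`, `v = 0` (both with `t = 1`)
of the permutations with `k` valleys; complementation then exchanges valleys and peaks at the cost
of swapping `p` and `q`, in which the weights of the paths are symmetric.
-/

namespace PermStat

open Finset

/-! ### Weighted Motzkin paths -/

section Motzkin

variable {R S : Type*} [CommSemiring R] [CommSemiring S]

/-- The `(p,q)`-analogue `∑_{i < k} q^i p^(k-1-i)` of the natural number `k`. -/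
def pqNat (p q : R) (k : ℕ) : R := ∑ i ∈ range k, q ^ i * p ^ (k - 1 - i)

theorem pqNat_comm (p q : R) (k : ℕ) : pqNat p q k = pqNat q p k :=
  geom_sum₂_comm q p k

theorem map_pqNat (f : R →+* S) (p q : R) (k : ℕ) : f (pqNat p q k) = pqNat (f p) (f q) k :=
  RingHom.map_geom_sum₂ q p k f

theorem pqNat_succ (p q : R) (k : ℕ) : pqNat p q (k + 1) = q ^ k + p * pqNat p q k := by
  rw [pqNat, sum_range_succ, pqNat, mul_sum, add_comm, Nat.add_sub_cancel, Nat.sub_self, pow_zero,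
    mul_one]
  refine congrArg _ (sum_congr rfl fun i hi => ?_)
  rw [mul_left_comm, ← pow_succ', show k - 1 - i + 1 = k - i by have := mem_range.1 hi; omega]

theorem add_dvd_pqNat_of_even (p q : R) {k : ℕ} (hk : Even k) : p + q ∣ pqNat p q k := by
  induction k using Nat.twoStepInduction with
  | zero => simp [pqNat]
  | one => simp at hk
  | more k ih _ =>
    have hrec : pqNat p q (k + 2) = (p + q) * q ^ k + p ^ 2 * pqNat p q k := by
      rw [pqNat_succ, pqNat_succ]; ring
    rw [hrec]
    exact dvd_add (dvd_mul_right _ _) ((ih (by grind)).mul_left _)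

/-- The weighted sum over the Motzkin paths with `m` steps from height `h` to height `0` that visit
height `0` only at their end; a step starting at height `i` has weight `c i` times `x` (up),
`y` (level) or `z` (down). -/
def motzkinSum (c : ℕ → R) (x y z : R) : ℕ → ℕ → R
  | 0, 0 => 1
  | 0, _ + 1 => 0
  | _ + 1, 0 => 0
  | m + 1, h + 1 => c (h + 1) * (x * motzkinSum c x y z m (h + 2) +
      y * motzkinSum c x y z m (h + 1) + z * motzkinSum c x y z m h)

/-- The part of `motzkinSum c 1 1 1 m h` coming from the paths with exactly `k` up steps; such a
path has `k + h` down steps and `m - h - 2 * k` level steps. -/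
def motzkinCoeff (c : ℕ → R) : ℕ → ℕ → ℕ → R
  | 0, 0, 0 => 1
  | 0, 0, _ + 1 => 0
  | 0, _ + 1, _ => 0
  | _ + 1, 0, _ => 0
  | m + 1, h + 1, 0 => c (h + 1) * (motzkinCoeff c m (h + 1) 0 + motzkinCoeff c m h 0)
  | m + 1, h + 1, k + 1 => c (h + 1) * (motzkinCoeff c m (h + 2) k +
      motzkinCoeff c m (h + 1) (k + 1) + motzkinCoeff c m h (k + 1))

theorem map_motzkinCoeff (f : R →+* S) (c : ℕ → R) (m h k : ℕ) :
    f (motzkinCoeff c m h k) = motzkinCoeff (fun i => f (c i)) m h k := by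
  fun_induction motzkinCoeff c m h k <;> simp_all [motzkinCoeff]

theorem motzkinCoeff_eq_zero (c : ℕ → R) {m h k : ℕ} (hm : m < h + 2 * k) :
    motzkinCoeff c m h k = 0 := by
  fun_induction motzkinCoeff c m h k with
  | case1 => omega
  | case2 | case3 | case4 => rfl
  | case5 m h ih₁ ih₂ => rw [ih₁ (by omega), ih₂ (by omega), add_zero, mul_zero]
  | case6 m h k ih₁ ih₂ ih₃ =>
    rw [ih₁ (by omega), ih₂ (by omega), ih₃ (by omega), add_zero, add_zero, mul_zero]

/-- Each up step is matched with a later down step between the same two heights, and one of these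
two steps starts at an even height; so does every second one of the `h` unmatched down steps. -/
theorem pow_dvd_motzkinCoeff {c : ℕ → R} {d : R} (hc : ∀ i, Even i → d ∣ c i) (m h k : ℕ) :
    d ^ (k + h / 2) ∣ motzkinCoeff c m h k := by
  have hstep : ∀ {e e' i : ℕ} {s : R}, d ^ e' ∣ s → e ≤ e' ∨ Even i ∧ e ≤ e' + 1 →
      d ^ e ∣ c i * s := by
    rintro e e' i s hs (he | ⟨hi, he⟩)
    · exact ((pow_dvd_pow d he).trans hs).mul_left _
    · exact (pow_dvd_pow d he).trans (pow_succ' d e' ▸ mul_dvd_mul (hc i hi) hs)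
  fun_induction motzkinCoeff c m h k with
  | case1 => simp
  | case2 | case3 | case4 => exact dvd_zero _
  | case5 m h ih₁ ih₂ =>
    rw [mul_add]
    exact dvd_add (hstep ih₁ (by omega)) (hstep ih₂ (by grind))
  | case6 m h k ih₁ ih₂ ih₃ =>
    rw [mul_add, mul_add]
    exact dvd_add (dvd_add (hstep ih₁ (by grind)) (hstep ih₂ (by omega))) (hstep ih₃ (by grind))

theorem motzkinSum_eq_sum (c : ℕ → R) (x y z : R) {m h K : ℕ} (hK : m < h + 2 * K) :
    motzkinSum c x y z m h =
      ∑ k ∈ range K, motzkinCoeff c m h k * x ^ k * y ^ (m - h - 2 * k) * z ^ (k + h) := by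
  fun_induction motzkinSum c x y z m h generalizing K with
  | case1 =>
    obtain ⟨K, rfl⟩ : ∃ K', K = K' + 1 := ⟨K - 1, by omega⟩
    rw [sum_range_succ']
    simp [motzkinCoeff]
  | case2 => simp [motzkinCoeff]
  | case3 => simp [motzkinCoeff]
  | case4 m h ih_up ih_level ih_down =>
    have hlevel : ∀ k,
        motzkinCoeff c m (h + 1) k * x ^ k * y ^ (m - h - 2 * k) * z ^ (k + (h + 1)) =
          y * (motzkinCoeff c m (h + 1) k * x ^ k * y ^ (m - (h + 1) - 2 * k) *
            z ^ (k + (h + 1))) := by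
      intro k
      rcases lt_or_ge m (h + 1 + 2 * k) with hlt | hge
      · simp only [motzkinCoeff_eq_zero c hlt, zero_mul, mul_zero]
      · rw [show m - h - 2 * k = m - (h + 1) - 2 * k + 1 by omega]; ring
    rw [ih_level (K := K) (by omega), ih_down (K := K) (by omega)]
    obtain _ | K := K
    · rw [ih_up (K := 0) (by omega)]; simp
    rw [ih_up (K := K) (by omega), mul_sum _ _ y, sum_congr rfl fun k _ => (hlevel k).symm]
    simp only [Nat.succ_sub_succ, Nat.succ_eq_add_one, sum_range_succ', mul_add, mul_sum,
      ← add_assoc, ← sum_add_distrib, add_right_comm _ _ (∑ _ ∈ _, _)]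
    rw [add_assoc]
    congr 1
    · refine sum_congr rfl fun k _ => ?_
      rw [motzkinCoeff, show m - (h + 2) - 2 * k = m - h - (2 * k + 2 * 1) by omega]
      ring
    · rw [motzkinCoeff]
      ring

end Motzkin


/-! ### Barred permutations -/

theorem sum_card_lt_card_gt {α M : Type*} [LinearOrder α] [AddCommMonoid M] (s : Finset α)
    (f : ℕ → ℕ → M) :
    ∑ j ∈ s, f #{g ∈ s | g < j} #{g ∈ s | j < g} = ∑ a ∈ range #s, f a (#s - 1 - a) := by
  rw [← Fin.sum_univ_eq_sum_range fun a => f a (#s - 1 - a)]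
  conv_lhs => rw [← s.map_orderEmbOfFin_univ rfl]
  rw [sum_map]
  refine sum_congr rfl fun i _ => ?_
  have hIoi : #s - 1 - i = #(Ioi i) := (Fin.card_Ioi i).symm
  rw [filter_map, filter_map, card_map, card_map, hIoi, ← Fin.card_Iio i, ← filter_gt_eq_Iio,
    ← filter_lt_eq_Ioi]
  simp only [Function.comp_def, RelEmbedding.coe_toEmbedding, OrderEmbedding.lt_iff_lt]

theorem sum_range_ite_insert_eq {M : Type*} [AddCommMonoid M] (f : ℕ → ℕ → M) {h N : ℕ}
    (a b : Bool) (hN : h + 2 = N + a.toNat + b.toNat) :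
    (∑ x ∈ range N, if 1 ≤ x + a.toNat ∧ 1 ≤ N - 1 - x + b.toNat then
      f (x + a.toNat - 1) (N - 1 - x + b.toNat - 1) else 0) = ∑ i ∈ range h, f i (h - 1 - i) := by
  have ha := a.toNat_le
  have hb := b.toNat_le
  rw [← sum_filter]
  refine sum_nbij' (fun x => x + a.toNat - 1) (fun i => i + 1 - a.toNat) ?_ ?_ ?_ ?_ ?_ <;>
    simp only [mem_filter, mem_range] <;> intro x hx
  · omega
  · omega
  · omega
  · omega
  · congr 1; omega

section Barred

variable {m : ℕ}

/-- A barred permutation is a permutation `σ` of `Fin m` with a choice `β` of bars in the `m + 1`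
gaps before, between and after its letters, a bar acting as a letter smaller than all the others.
This tests whether the letter or bar directly to the left of position `k` is smaller than `c`. -/
def leftBelow (σ : Equiv.Perm (Fin m)) (β : Fin (m + 1) → Bool) (c k : Fin m) : Bool :=
  β k.castSucc || decide (∃ l : Fin m, k.castSucc = l.succ ∧ σ l < c)

/-- Whether the letter or bar directly to the right of position `k` is smaller than `c`. -/
def rightBelow (σ : Equiv.Perm (Fin m)) (β : Fin (m + 1) → Bool) (c k : Fin m) : Bool :=
  β k.succ || decide (∃ l : Fin m, k.succ = l.castSucc ∧ σ l < c)

/-- The number of descents to the left of position `i` across the value `σ i`. -/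
def leftCross (σ : Equiv.Perm (Fin m)) (β : Fin (m + 1) → Bool) (i : Fin m) : ℕ :=
  #{k | k < i ∧ σ i < σ k ∧ rightBelow σ β (σ i) k}

/-- The number of ascents to the right of position `i` across the value `σ i`. -/
def rightCross (σ : Equiv.Perm (Fin m)) (β : Fin (m + 1) → Bool) (i : Fin m) : ℕ :=
  #{k | i < k ∧ σ i < σ k ∧ leftBelow σ β (σ i) k}

/-- The permutation obtained from `τ` by inserting a new smallest letter at position `j`. -/
def insertMin (j : Fin (m + 1)) (τ : Equiv.Perm (Fin m)) : Equiv.Perm (Fin (m + 1)) :=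
  ((finSuccEquiv' j).trans (Equiv.optionCongr τ)).trans (finSuccEquiv' 0).symm

@[simp]
theorem insertMin_self (j : Fin (m + 1)) (τ : Equiv.Perm (Fin m)) : insertMin j τ j = 0 := by
  simp [insertMin]

@[simp]
theorem insertMin_succAbove (j : Fin (m + 1)) (τ : Equiv.Perm (Fin m)) (i : Fin m) :
    insertMin j τ (j.succAbove i) = (τ i).succ := by
  simp [insertMin]

theorem insertMin_pos_of_ne {j k : Fin (m + 1)} (τ : Equiv.Perm (Fin m)) (hk : k ≠ j) :
    0 < insertMin j τ k := by
  obtain ⟨i, rfl⟩ := Fin.exists_succAbove_eq hk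
  simp

theorem insertMin_bijective :
    Function.Bijective fun x : Fin (m + 1) × Equiv.Perm (Fin m) => insertMin x.1 x.2 := by
  rw [Fintype.bijective_iff_injective_and_card]
  constructor
  · rintro ⟨j, τ⟩ ⟨j', τ'⟩ (h : insertMin j τ = insertMin j' τ')
    obtain rfl : j = j' :=
      (insertMin j' τ').injective (by rw [insertMin_self, ← h, insertMin_self])
    have hτ : τ = τ' := Equiv.ext fun i => by simpa using DFunLike.congr_fun h (j.succAbove i)
    rw [hτ]
  · simp [Fintype.card_perm, Nat.factorial_succ]

theorem sum_perm_succ {M : Type*} [AddCommMonoid M] (f : Equiv.Perm (Fin (m + 1)) → M) :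
    ∑ σ, f σ = ∑ j, ∑ τ, f (insertMin j τ) := by
  rw [← insertMin_bijective.sum_comp, Fintype.sum_prod_type]

/-- The bars obtained from `β` by splitting the gap `j` into two, with bars as prescribed by `a` on
the left and by `b` on the right. -/
def splitGap (j : Fin (m + 1)) (a b : Bool) (β : Fin (m + 1) → Bool) : Fin (m + 2) → Bool :=
  Fin.insertNth (α := fun _ => Bool) j.castSucc a (Function.update β j b)

@[simp]
theorem splitGap_castSucc (j : Fin (m + 1)) (a b : Bool) (β : Fin (m + 1) → Bool) :
    splitGap j a b β j.castSucc = a := by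
  simp [splitGap]

@[simp]
theorem splitGap_castSucc_succAbove (j : Fin (m + 1)) (a b : Bool) (β : Fin (m + 1) → Bool)
    (g : Fin (m + 1)) :
    splitGap j a b β (j.castSucc.succAbove g) = Function.update β j b g := by
  simp [splitGap]

@[simp]
theorem splitGap_succ (j : Fin (m + 1)) (a b : Bool) (β : Fin (m + 1) → Bool) :
    splitGap j a b β j.succ = b := by
  rw [← Fin.succAbove_castSucc_self, splitGap_castSucc_succAbove, Function.update_self]

@[simp]
theorem splitGap_succ_succAbove (j : Fin (m + 1)) (a b : Bool) (β : Fin (m + 1) → Bool)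
    (g : Fin (m + 1)) :
    splitGap j a b β (j.succ.succAbove g) = Function.update β j a g := by
  rcases eq_or_ne g j with rfl | hg
  · simp
  · have hg' : j.succ.succAbove g = j.castSucc.succAbove g := by grind [Fin.succAbove]
    simp [hg', hg]

theorem castSucc_succAbove_eq_succ_succAbove_iff (j g g' : Fin (m + 1)) :
    j.castSucc.succAbove g = j.succ.succAbove g' ↔ g = g' ∧ g ≠ j := by
  grind [Fin.succAbove]

theorem succ_succAbove_eq_castSucc_succAbove_iff (j g g' : Fin (m + 1)) :
    j.succ.succAbove g = j.castSucc.succAbove g' ↔ g = g' ∧ g ≠ j := by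
  grind [Fin.succAbove]

theorem leftBelow_insertMin {j : Fin (m + 1)} {β : Fin (m + 1) → Bool} (hβ : β j) (a b : Bool)
    (τ : Equiv.Perm (Fin m)) (c k : Fin m) :
    leftBelow (insertMin j τ) (splitGap j a b β) c.succ (j.succAbove k) = leftBelow τ β c k := by
  have hself : j.castSucc.succAbove k.castSucc = j.succ ↔ k.castSucc = j := by
    rw [← Fin.succAbove_castSucc_self, Fin.succAbove_right_inj]
  rw [leftBelow, leftBelow, Bool.eq_iff_iff]
  simp only [Fin.exists_iff_succAbove j, ← Fin.castSucc_succAbove_castSucc,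
    ← Fin.succ_succAbove_succ, splitGap_castSucc_succAbove, insertMin_self, insertMin_succAbove,
    castSucc_succAbove_eq_succ_succAbove_iff, hself, Fin.succ_pos, Fin.succ_lt_succ_iff]
  by_cases hk : k.castSucc = j
  · simp [hk, hβ]
  · simp [hk]

theorem rightBelow_insertMin {j : Fin (m + 1)} {β : Fin (m + 1) → Bool} (hβ : β j) (a b : Bool)
    (τ : Equiv.Perm (Fin m)) (c k : Fin m) :
    rightBelow (insertMin j τ) (splitGap j a b β) c.succ (j.succAbove k) = rightBelow τ β c k := by
  have hself : j.succ.succAbove k.succ = j.castSucc ↔ k.succ = j := by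
    rw [← Fin.succAbove_succ_self, Fin.succAbove_right_inj]
  rw [rightBelow, rightBelow, Bool.eq_iff_iff]
  simp only [Fin.exists_iff_succAbove j, ← Fin.castSucc_succAbove_castSucc,
    ← Fin.succ_succAbove_succ, splitGap_succ_succAbove, insertMin_self, insertMin_succAbove,
    succ_succAbove_eq_castSucc_succAbove_iff, hself, Fin.succ_pos, Fin.succ_lt_succ_iff]
  by_cases hk : k.succ = j
  · simp [hk, hβ]
  · simp [hk]

theorem leftCross_insertMin {j : Fin (m + 1)} {β : Fin (m + 1) → Bool} (hβ : β j) (a b : Bool)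
    (τ : Equiv.Perm (Fin m)) (i : Fin m) :
    leftCross (insertMin j τ) (splitGap j a b β) (j.succAbove i) = leftCross τ β i := by
  rw [leftCross, leftCross, card_filter, card_filter, Fin.sum_univ_succAbove _ j]
  simp [rightBelow_insertMin hβ, Fin.succAbove_lt_succAbove_iff]

theorem rightCross_insertMin {j : Fin (m + 1)} {β : Fin (m + 1) → Bool} (hβ : β j) (a b : Bool)
    (τ : Equiv.Perm (Fin m)) (i : Fin m) :
    rightCross (insertMin j τ) (splitGap j a b β) (j.succAbove i) = rightCross τ β i := by
  rw [rightCross, rightCross, card_filter, card_filter, Fin.sum_univ_succAbove _ j]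
  simp [leftBelow_insertMin hβ, Fin.succAbove_lt_succAbove_iff]

theorem leftBelow_zero (σ : Equiv.Perm (Fin (m + 1))) (β : Fin (m + 2) → Bool)
    (k : Fin (m + 1)) : leftBelow σ β 0 k = β k.castSucc := by
  simp [leftBelow]

theorem rightBelow_zero (σ : Equiv.Perm (Fin (m + 1))) (β : Fin (m + 2) → Bool)
    (k : Fin (m + 1)) : rightBelow σ β 0 k = β k.succ := by
  simp [rightBelow]

theorem card_splitGap_le_castSucc (j : Fin (m + 1)) (a b : Bool) (β : Fin (m + 1) → Bool) :
    #{g | splitGap j a b β g ∧ g ≤ j.castSucc} = #{g | β g ∧ g < j} + a.toNat := by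
  have hlt : ∀ g, (Function.update β j b g ∧ j.castSucc.succAbove g ≤ j.castSucc) ↔
      β g ∧ g < j := by
    grind [Fin.succAbove]
  rw [card_filter, card_filter, Fin.sum_univ_succAbove _ j.castSucc]
  simp only [splitGap_castSucc, splitGap_castSucc_succAbove, hlt]
  cases a <;> simp [add_comm]

theorem card_splitGap_succ_le (j : Fin (m + 1)) (a b : Bool) (β : Fin (m + 1) → Bool) :
    #{g | splitGap j a b β g ∧ j.succ ≤ g} = #{g | β g ∧ j < g} + b.toNat := by
  have hlt : ∀ g, (Function.update β j a g ∧ j.succ ≤ j.succ.succAbove g) ↔ β g ∧ j < g := by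
    grind [Fin.succAbove]
  rw [card_filter, card_filter, Fin.sum_univ_succAbove _ j.succ]
  simp only [splitGap_succ, splitGap_succ_succAbove, hlt]
  cases b <;> simp [add_comm]

theorem card_splitGap {j : Fin (m + 1)} {β : Fin (m + 1) → Bool} (hβ : β j) (a b : Bool) :
    #{g | splitGap j a b β g} + 1 = #{g | β g} + a.toNat + b.toNat := by
  simp only [card_filter]
  rw [Fin.sum_univ_succAbove _ j.castSucc, Fin.sum_univ_succAbove _ j,
    Fin.sum_univ_succAbove (fun g => if β g = true then 1 else 0) j]
  simp only [splitGap_castSucc, splitGap_castSucc_succAbove, Function.update_self, ne_eq,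
    Fin.succAbove_ne, not_false_eq_true, Function.update_of_ne, hβ]
  cases a <;> cases b <;> simp <;> omega

theorem splitGap_zero_iff {j : Fin (m + 1)} {β : Fin (m + 1) → Bool} (hβ : β j) (a b : Bool) :
    splitGap j a b β 0 ↔ β 0 ∧ 1 ≤ #{g | β g ∧ g < j} + a.toNat := by
  rcases eq_or_ne j 0 with rfl | hj
  · have hzero : splitGap 0 a b β 0 = a := splitGap_castSucc 0 a b β
    cases a <;> simp [hzero, hβ]
  · have hzero := splitGap_castSucc_succAbove j a b β 0
    rw [Fin.succAbove_ne_zero_zero (by simpa using hj), Function.update_of_ne hj.symm] at hzero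
    rw [hzero, iff_self_and]
    exact fun h0 => Nat.le_add_right_of_le (card_pos.2 ⟨0, by simp [h0, Fin.pos_iff_ne_zero, hj]⟩)

theorem splitGap_last_iff {j : Fin (m + 1)} {β : Fin (m + 1) → Bool} (hβ : β j) (a b : Bool) :
    splitGap j a b β (Fin.last _) ↔ β (Fin.last m) ∧ 1 ≤ #{g | β g ∧ j < g} + b.toNat := by
  rcases eq_or_ne j (Fin.last m) with rfl | hj
  · have hlast : splitGap (Fin.last m) a b β (Fin.last _) = b := splitGap_succ (Fin.last m) a b β
    cases b <;> simp [hlast, hβ, Fin.le_last]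
  · have hlast := splitGap_succ_succAbove j a b β (Fin.last m)
    rw [Fin.succAbove_ne_last_last (by simpa [Fin.ext_iff] using hj),
      Function.update_of_ne hj.symm] at hlast
    rw [hlast, iff_self_and]
    exact fun h1 => Nat.le_add_right_of_le
      (card_pos.2 ⟨Fin.last m, by simp [h1, Fin.lt_last_iff_ne_last, hj]⟩)

theorem leftCross_insertMin_self {j : Fin (m + 1)} {a b : Bool} {β : Fin (m + 1) → Bool}
    (τ : Equiv.Perm (Fin m)) (h0 : splitGap j a b β 0) :
    leftCross (insertMin j τ) (splitGap j a b β) j + 1 = #{g | β g ∧ g < j} + a.toNat := by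
  rw [← card_splitGap_le_castSucc j a b β, leftCross, card_filter, card_filter,
    Fin.sum_univ_succ (n := m + 1), add_comm, if_pos ⟨h0, Fin.zero_le _⟩]
  refine congrArg _ (sum_congr rfl fun k _ => if_congr ?_ rfl rfl)
  rw [insertMin_self, rightBelow_zero, Fin.succ_le_castSucc_iff]
  exact ⟨fun h => ⟨h.2.2, h.1⟩, fun h => ⟨h.2, insertMin_pos_of_ne τ h.2.ne, h.1⟩⟩

theorem rightCross_insertMin_self {j : Fin (m + 1)} {a b : Bool} {β : Fin (m + 1) → Bool}
    (τ : Equiv.Perm (Fin m)) (h1 : splitGap j a b β (Fin.last _)) :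
    rightCross (insertMin j τ) (splitGap j a b β) j + 1 = #{g | β g ∧ j < g} + b.toNat := by
  rw [← card_splitGap_succ_le j a b β, rightCross, card_filter, card_filter,
    Fin.sum_univ_castSucc (n := m + 1), if_pos ⟨h1, Fin.le_last _⟩]
  refine congrArg (· + 1) (sum_congr rfl fun k _ => if_congr ?_ rfl rfl)
  rw [insertMin_self, leftBelow_zero, Fin.succ_le_castSucc_iff]
  exact ⟨fun h => ⟨h.2.2, h.1⟩, fun h => ⟨h.2, insertMin_pos_of_ne τ h.2.ne', h.1⟩⟩

theorem sum_bars_succ {M : Type*} [AddCommMonoid M] (j : Fin (m + 1))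
    (f : (Fin (m + 2) → Bool) → M) :
    ∑ β, f β = ∑ a, ∑ b, ∑ β : Fin (m + 1) → Bool with β j, f (splitGap j a b β) := by
  rw [← (Fin.insertNthEquiv (fun _ => Bool) j.castSucc).sum_comp, Fintype.sum_prod_type]
  refine sum_congr rfl fun a _ => ?_
  rw [← (Fin.insertNthEquiv (fun _ => Bool) j).sum_comp, Fintype.sum_prod_type]
  refine sum_congr rfl fun b _ => ?_
  rw [sum_filter, ← (Fin.insertNthEquiv (fun _ => Bool) j).sum_comp, Fintype.sum_prod_type]
  simp only [Fin.insertNthEquiv_apply, Fintype.sum_bool, Fin.insertNth_apply_same, if_true,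
    Bool.false_eq_true, if_false, sum_const_zero, add_zero]
  refine sum_congr rfl fun β _ => congrArg (fun γ => f (j.castSucc.insertNth a γ)) ?_
  exact (Fin.update_insertNth (α := fun _ => Bool) j true b β).symm

theorem sum_barred_succ {M : Type*} [AddCommMonoid M]
    (f : Equiv.Perm (Fin (m + 1)) → (Fin (m + 2) → Bool) → M) :
    ∑ σ, ∑ β, f σ β = ∑ a, ∑ b, ∑ τ, ∑ β : Fin (m + 1) → Bool, ∑ j with β j,
      f (insertMin j τ) (splitGap j a b β) := by
  rw [sum_perm_succ]
  simp only [fun (τ : Equiv.Perm (Fin m)) (j : Fin (m + 1)) => sum_bars_succ j (f (insertMin j τ))]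
  simp only [sum_comm (s := (univ : Finset (Equiv.Perm (Fin m)))) (t := (univ : Finset Bool)),
    sum_comm (s := (univ : Finset (Fin (m + 1)))) (t := (univ : Finset Bool))]
  refine sum_congr rfl fun a _ => sum_congr rfl fun b _ => sum_comm.trans ?_
  exact sum_congr rfl fun τ _ => sum_comm' (by simp)

/-- The placements of `h + 1` bars, one of them at each end. -/
def bars (m h : ℕ) : Finset (Fin (m + 1) → Bool) :=
  {β | β 0 ∧ β (Fin.last m) ∧ #{g | β g} = h + 1}

theorem mem_bars {h : ℕ} {β : Fin (m + 1) → Bool} :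
    β ∈ bars m h ↔ β 0 ∧ β (Fin.last m) ∧ #{g | β g} = h + 1 := by
  simp [bars]

theorem splitGap_mem_bars_iff {j : Fin (m + 1)} {β : Fin (m + 1) → Bool} (hβ : β j) {a b : Bool}
    {h h' : ℕ} (hh : h + 1 = h' + a.toNat + b.toNat) :
    splitGap j a b β ∈ bars (m + 1) h ↔ β ∈ bars m h' ∧
      1 ≤ #{g | β g ∧ g < j} + a.toNat ∧ 1 ≤ #{g | β g ∧ j < g} + b.toNat := by
  have hcard := card_splitGap hβ a b
  rw [mem_bars, mem_bars, splitGap_zero_iff hβ, splitGap_last_iff hβ,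
    show #{g | splitGap j a b β g} = h + 1 ↔ #{g | β g} = h' + 1 by omega]
  tauto

variable {R : Type*} [CommSemiring R]

/-- The weight of a barred permutation; `T` is the weight of a letter, depending on whether its left
and its right neighbours are smaller. -/
def barredWeight (p q : R) (T : Bool → Bool → R) (σ : Equiv.Perm (Fin m))
    (β : Fin (m + 1) → Bool) : R :=
  ∏ i, q ^ leftCross σ β i * p ^ rightCross σ β i *
    T (leftBelow σ β (σ i) i) (rightBelow σ β (σ i) i)

/-- The generating function of the barred permutations of `Fin m` with `h + 1` bars. -/
def barredSum (p q : R) (T : Bool → Bool → R) (m h : ℕ) : R :=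
  ∑ σ : Equiv.Perm (Fin m), ∑ β ∈ bars m h, barredWeight p q T σ β

theorem barredWeight_insertMin (p q : R) (T : Bool → Bool → R) {j : Fin (m + 1)} {a b : Bool}
    (τ : Equiv.Perm (Fin m)) {β : Fin (m + 1) → Bool} (hβ : β j) (h0 : splitGap j a b β 0)
    (h1 : splitGap j a b β (Fin.last _)) :
    barredWeight p q T (insertMin j τ) (splitGap j a b β) =
      q ^ (#{g | β g ∧ g < j} + a.toNat - 1) * p ^ (#{g | β g ∧ j < g} + b.toNat - 1) * T a b *
        barredWeight p q T τ β := by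
  rw [barredWeight, Fin.prod_univ_succAbove _ j, ← leftCross_insertMin_self τ h0,
    ← rightCross_insertMin_self τ h1]
  simp [barredWeight, leftCross_insertMin hβ, rightCross_insertMin hβ, leftBelow_insertMin hβ,
    rightBelow_insertMin hβ, leftBelow_zero, rightBelow_zero]

theorem sum_barredWeight_insertMin (p q : R) (T : Bool → Bool → R) {h h' : ℕ} {a b : Bool}
    (hh : h + 2 = h' + a.toNat + b.toNat) (τ : Equiv.Perm (Fin m)) (β : Fin (m + 1) → Bool) :
    (∑ j with β j, if splitGap j a b β ∈ bars (m + 1) (h + 1) then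
      barredWeight p q T (insertMin j τ) (splitGap j a b β) else 0) =
    if β ∈ bars m h' then pqNat p q (h + 1) * T a b * barredWeight p q T τ β else 0 := by
  split_ifs with hβ
  · have hcard : #{g | β g} = h' + 1 := (mem_bars.1 hβ).2.2
    rw [pqNat, ← sum_range_ite_insert_eq (fun i k => q ^ i * p ^ k) (N := #{g | β g}) a b
      (by omega), ← sum_card_lt_card_gt {g | β g} fun x y =>
        if 1 ≤ x + a.toNat ∧ 1 ≤ y + b.toNat then
          q ^ (x + a.toNat - 1) * p ^ (y + b.toNat - 1) else 0, sum_mul, sum_mul]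
    refine sum_congr rfl fun j hj => ?_
    have hj : β j := (mem_filter.1 hj).2
    simp only [filter_filter, ite_mul, zero_mul]
    have hmem := splitGap_mem_bars_iff hj hh
    rw [and_iff_right hβ] at hmem
    simp only [← hmem]
    split_ifs with hs
    · exact barredWeight_insertMin p q T τ hj (mem_bars.1 hs).1 (mem_bars.1 hs).2.1
    · rfl
  · refine sum_eq_zero fun j hj => if_neg fun hs => hβ ?_
    exact ((splitGap_mem_bars_iff (mem_filter.1 hj).2 hh).1 hs).1

theorem barredSum_succ (p q : R) (T : Bool → Bool → R) (m h : ℕ) :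
    barredSum p q T (m + 1) (h + 1) = pqNat p q (h + 1) *
      (T false false * barredSum p q T m (h + 2) +
        (T true false + T false true) * barredSum p q T m (h + 1) +
        T true true * barredSum p q T m h) := by
  have hsum : ∀ {a b : Bool} {h' : ℕ}, h + 2 = h' + a.toNat + b.toNat →
      (∑ τ : Equiv.Perm (Fin m), ∑ β, ∑ j with β j, if splitGap j a b β ∈ bars (m + 1) (h + 1) then
        barredWeight p q T (insertMin j τ) (splitGap j a b β) else 0) =
      pqNat p q (h + 1) * T a b * barredSum p q T m h' := fun hh => by
    simp only [sum_barredWeight_insertMin p q T hh, barredSum, mul_sum, sum_ite_mem, univ_inter]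
  have hbars : barredSum p q T (m + 1) (h + 1) = ∑ σ : Equiv.Perm (Fin (m + 1)), ∑ β,
      if β ∈ bars (m + 1) (h + 1) then barredWeight p q T σ β else 0 := by
    simp only [barredSum, sum_ite_mem, univ_inter]
  rw [hbars, sum_barred_succ]
  simp only [Fintype.sum_bool]
  rw [hsum (h' := h) rfl, hsum (h' := h + 1) rfl, hsum (h' := h + 1) rfl, hsum (h' := h + 2) rfl]
  ring

theorem bars_succ_zero (m : ℕ) : bars (m + 1) 0 = ∅ := by
  refine eq_empty_of_forall_notMem fun β hβ => ?_
  obtain ⟨h0, h1, hcard⟩ := mem_bars.1 hβ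
  have := card_le_one.1 hcard.le 0 (by simpa using h0) (Fin.last _) (by simpa using h1)
  simp [Fin.ext_iff] at this

theorem bars_zero (h : ℕ) : bars 0 h = if h = 0 then {fun _ => true} else ∅ := by
  ext β
  obtain ⟨x, rfl⟩ : ∃ x, β = fun _ => x :=
    ⟨β 0, funext fun g => congrArg β (Fin.fin_one_eq_zero g)⟩
  cases x <;> cases h <;> simp [mem_bars, funext_iff]

theorem barredSum_eq_motzkinSum (p q : R) (T : Bool → Bool → R) (m h : ℕ) :
    barredSum p q T m h = motzkinSum (pqNat p q) (T false false) (T true false + T false true)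
      (T true true) m h := by
  induction m generalizing h with
  | zero =>
    obtain _ | h := h
    · simp [barredSum, bars_zero, barredWeight, motzkinSum]
    · simp [barredSum, bars_zero, motzkinSum]
  | succ m ih =>
    obtain _ | h := h
    · simp [barredSum, bars_succ_zero, motzkinSum]
    · rw [barredSum_succ, motzkinSum, ih, ih, ih]

end Barred

/-! ### Words and statistics -/

section Statistics

variable {n : ℕ}

theorem word_succ (b : ℕ) (σ : Equiv.Perm (Fin n)) (i : Fin n) : word b σ (i + 1) = σ i + 1 := by
  simp [word]

theorem word_eq (b : ℕ) (σ : Equiv.Perm (Fin n)) {i : ℕ} (h1 : 1 ≤ i) (h2 : i ≤ n) :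
    word b σ i = σ ⟨i - 1, by omega⟩ + 1 :=
  dif_pos ⟨h1, h2⟩

theorem word_outside (b : ℕ) (σ : Equiv.Perm (Fin n)) {i : ℕ} (h : i = 0 ∨ n < i) :
    word b σ i = b :=
  dif_neg (by omega)

theorem word_ne_word_succ (hn : 1 ≤ n) (σ : Equiv.Perm (Fin n)) {i : ℕ} (hi : i ≤ n) :
    word 0 σ i ≠ word 0 σ (i + 1) := by
  obtain rfl | h0 := Nat.eq_zero_or_pos i
  · rw [word_outside 0 σ (Or.inl rfl), word_eq 0 σ le_rfl hn]
    omega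
  obtain rfl | h1 := hi.eq_or_lt
  · rw [word_outside 0 σ (i := i + 1) (by omega), word_eq 0 σ hn le_rfl]
    omega
  · rw [word_eq 0 σ h0 hi, word_eq 0 σ (by omega) h1, Ne, Nat.add_left_inj, Fin.val_inj,
      σ.injective.eq_iff, Fin.ext_iff]
    dsimp only
    omega

theorem card_filter_Icc_one (P : ℕ → Prop) [DecidablePred P] :
    #{i ∈ Icc 1 n | P i} = #{i : Fin n | P (i + 1)} := by
  symm
  refine card_bij (fun i _ => (i : ℕ) + 1) (fun i hi => ?_) (fun i _ j _ h => ?_) fun i hi => ?_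
  · exact mem_filter.2 ⟨mem_Icc.2 ⟨Nat.le_add_left 1 i, i.isLt⟩, (mem_filter.1 hi).2⟩
  · exact Fin.ext (Nat.succ_injective h)
  · obtain ⟨hi, hP⟩ := mem_filter.1 hi
    obtain ⟨k, rfl⟩ := Nat.exists_eq_add_of_le' (mem_Icc.1 hi).1
    exact ⟨⟨k, (mem_Icc.1 hi).2⟩, by simpa using hP, rfl⟩

theorem des_eq (σ : Equiv.Perm (Fin n)) : des σ = doubleDescent 0 σ + valley 0 σ := by
  have hdes : des σ = #{i ∈ Icc 1 n | word 0 σ (i - 1) > word 0 σ i} := by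
    refine card_nbij' (· + 1) (· - 1) ?_ ?_ ?_ ?_ <;> intro i hi <;>
      simp only [coe_filter, mem_Icc, Set.mem_ofPred_eq] at hi ⊢
    · exact ⟨by omega, hi.2.2⟩
    · have h1 : i ≠ 1 := by
        rintro rfl
        exact Nat.not_lt_zero _ (word_outside 0 σ (Or.inl rfl) ▸ hi.2)
      rw [Nat.sub_add_cancel hi.1.1]
      exact ⟨by omega, by omega, hi.2⟩
    · rfl
    · omega
  rw [hdes, doubleDescent, valley,
    ← card_filter_add_card_filter_not (fun i => word 0 σ i > word 0 σ (i + 1)), filter_filter,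
    filter_filter]
  congr 2
  refine filter_congr fun i hi => and_congr_right fun _ => ?_
  have hi := mem_Icc.1 hi
  have := word_ne_word_succ (by omega) σ hi.2
  omega

/-- The placement of bars at the two ends only. -/
def endBars (n : ℕ) : Fin (n + 1) → Bool := fun g => decide (g = 0 ∨ g = Fin.last n)

theorem bars_one (hn : 1 ≤ n) : bars n 1 = {endBars n} := by
  have hcard : #({0, Fin.last n} : Finset (Fin (n + 1))) = 2 :=
    card_pair (by rw [Ne, Fin.ext_iff, Fin.val_zero, Fin.val_last]; omega)
  have hend : ∀ β, β = endBars n ↔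
      ({0, Fin.last n} : Finset (Fin (n + 1))) = ({g | β g} : Finset _) := fun β => by
    simp only [funext_iff, Finset.ext_iff, mem_insert, mem_singleton, mem_filter, mem_univ,
      true_and, endBars]
    exact forall_congr' fun g => by grind
  ext β
  rw [mem_bars, mem_singleton, hend]
  constructor
  · rintro ⟨h0, h1, hβ⟩
    exact eq_of_subset_of_card_le (by simp [insert_subset_iff, h0, h1]) (by rw [hβ, hcard])
  · intro h
    rw [← h, hcard]
    simp only [Finset.ext_iff, mem_filter, mem_univ, true_and] at h
    simp [← h]

theorem leftBelow_endBars (σ : Equiv.Perm (Fin n)) (c k : Fin n) :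
    leftBelow σ (endBars n) c k ↔ word 0 σ k < c + 1 := by
  obtain _ | n := n
  · exact k.elim0
  cases k using Fin.cases with
  | zero => simp [leftBelow, endBars, word]
  | succ l =>
    have hl := word_succ 0 σ l.castSucc
    rw [Fin.val_castSucc] at hl
    have hbar : endBars (n + 1) l.castSucc.succ = false := by
      simp [endBars, Fin.ext_iff, l.isLt.ne]
    simp only [leftBelow, hbar, Fin.val_succ, hl, ← Fin.succ_castSucc, Fin.succ_inj,
      Bool.false_or, decide_eq_true_eq, exists_eq_left', Nat.add_lt_add_iff_right, Fin.lt_def]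

theorem rightBelow_endBars (σ : Equiv.Perm (Fin n)) (c k : Fin n) :
    rightBelow σ (endBars n) c k ↔ word 0 σ (k + 2) < c + 1 := by
  obtain _ | n := n
  · exact k.elim0
  cases k using Fin.lastCases with
  | last => simp [rightBelow, endBars, word]
  | cast l =>
    have hl := word_succ 0 σ l.succ
    rw [Fin.val_succ] at hl
    have hbar : endBars (n + 1) l.succ.castSucc = false := by
      simp [endBars, Fin.ext_iff, l.isLt.ne]
    simp only [rightBelow, hbar, Fin.val_castSucc, hl, Fin.succ_castSucc, Fin.castSucc_inj,
      Bool.false_or, decide_eq_true_eq, exists_eq_left', Nat.add_lt_add_iff_right, Fin.lt_def]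

theorem les_eq (σ : Equiv.Perm (Fin n)) : les σ = ∑ i, leftCross σ (endBars n) i := by
  simp only [leftCross]
  rw [← card_sigma]
  symm
  refine card_bij (fun x _ => ((x.2 : ℕ) + 2, (x.1 : ℕ) + 1)) ?_ ?_ ?_
  · rintro ⟨i, k⟩ hx
    simp only [mem_sigma, mem_filter, mem_univ, true_and, rightBelow_endBars, Fin.lt_def] at hx
    have hne : (k : ℕ) + 1 ≠ i := by
      intro h
      rw [← word_succ 0 σ i, ← h] at hx
      exact lt_irrefl _ hx.2.2
    have hk := word_succ 0 σ k
    have hi := word_succ 0 σ i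
    simp only [mem_filter, mem_product, mem_Icc, show (k : ℕ) + 2 - 1 = k + 1 from rfl]
    omega
  · rintro ⟨i, k⟩ - ⟨i', k'⟩ - h
    simpa [Fin.ext_iff, and_comm] using h
  · rintro ⟨a, b⟩ hx
    simp only [mem_filter, mem_product, mem_Icc] at hx
    obtain ⟨k, rfl⟩ : ∃ k, a = k + 2 := ⟨a - 2, by omega⟩
    obtain ⟨i, rfl⟩ : ∃ i, b = i + 1 := ⟨b - 1, by omega⟩
    have hk : word 0 σ (k + 1) = σ ⟨k, by omega⟩ + 1 := word_succ 0 σ ⟨k, by omega⟩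
    have hi : word 0 σ (i + 1) = σ ⟨i, by omega⟩ + 1 := word_succ 0 σ ⟨i, by omega⟩
    refine ⟨⟨⟨i, by omega⟩, ⟨k, by omega⟩⟩, ?_, rfl⟩
    simp only [mem_sigma, mem_filter, mem_univ, true_and, rightBelow_endBars, Fin.lt_def]
    simp only [show k + 2 - 1 = k + 1 from rfl] at hx
    omega

theorem res_eq (σ : Equiv.Perm (Fin n)) : res σ = ∑ i, rightCross σ (endBars n) i := by
  simp only [rightCross]
  rw [← card_sigma]
  symm
  refine card_bij (fun x _ => ((x.1 : ℕ) + 1, (x.2 : ℕ))) ?_ ?_ ?_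
  · rintro ⟨i, k⟩ hx
    simp only [mem_sigma, mem_filter, mem_univ, true_and, leftBelow_endBars, Fin.lt_def] at hx
    have hne : (i : ℕ) + 1 ≠ k := by
      intro h
      rw [← word_succ 0 σ i, h] at hx
      omega
    have hk := word_succ 0 σ k
    have hi := word_succ 0 σ i
    simp only [mem_filter, mem_product, mem_Icc]
    omega
  · rintro ⟨i, k⟩ - ⟨i', k'⟩ - h
    simpa [Fin.ext_iff] using h
  · rintro ⟨a, k⟩ hx
    simp only [mem_filter, mem_product, mem_Icc] at hx
    obtain ⟨i, rfl⟩ : ∃ i, a = i + 1 := ⟨a - 1, by omega⟩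
    have hk : word 0 σ (k + 1) = σ ⟨k, by omega⟩ + 1 := word_succ 0 σ ⟨k, by omega⟩
    have hi : word 0 σ (i + 1) = σ ⟨i, by omega⟩ + 1 := word_succ 0 σ ⟨i, by omega⟩
    refine ⟨⟨⟨i, by omega⟩, ⟨k, by omega⟩⟩, ?_, rfl⟩
    simp only [mem_sigma, mem_filter, mem_univ, true_and, leftBelow_endBars, Fin.lt_def]
    omega

variable {R : Type*} [CommSemiring R]

theorem barredWeight_endBars (p q : R) (T : Bool → Bool → R) (σ : Equiv.Perm (Fin n)) :
    barredWeight p q T σ (endBars n) = p ^ res σ * q ^ les σ * T false false ^ valley 0 σ *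
      T true false ^ doubleAscent 0 σ * T false true ^ doubleDescent 0 σ *
      T true true ^ peak 0 σ := by
  have hletter : ∏ i, T (leftBelow σ (endBars n) (σ i) i) (rightBelow σ (endBars n) (σ i) i) =
      ∏ a, ∏ b, T a b ^ #{i | leftBelow σ (endBars n) (σ i) i = a ∧
        rightBelow σ (endBars n) (σ i) i = b} := by
    rw [← Fintype.prod_prod_type', ← prod_fiberwise univ fun i =>
      (leftBelow σ (endBars n) (σ i) i, rightBelow σ (endBars n) (σ i) i)]
    refine prod_congr rfl fun x _ => ?_
    simp only [Prod.ext_iff]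
    exact prod_eq_pow_card fun i hi => by rw [(mem_filter.1 hi).2.1, (mem_filter.1 hi).2.2]
  have hne : ∀ i : Fin n, word 0 σ i ≠ word 0 σ (i + 1) ∧
      word 0 σ (i + 1) ≠ word 0 σ (i + 2) := fun i =>
    ⟨word_ne_word_succ i.pos σ i.isLt.le, word_ne_word_succ i.pos σ i.isLt⟩
  have hgt : ∀ i : Fin n,
      (word 0 σ (i + 1) < word 0 σ i ↔ ¬ word 0 σ i < word 0 σ (i + 1)) ∧
      (word 0 σ (i + 1) < word 0 σ (i + 2) ↔ ¬ word 0 σ (i + 2) < word 0 σ (i + 1)) := fun i =>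
    ⟨(not_lt.trans (hne i).1.symm.le_iff_lt).symm, (not_lt.trans (hne i).2.le_iff_lt).symm⟩
  simp only [barredWeight, prod_mul_distrib, prod_pow_eq_pow_sum, ← les_eq, ← res_eq, hletter,
    Fintype.prod_bool, ← Bool.not_eq_true, leftBelow_endBars, rightBelow_endBars, ← word_succ 0 σ,
    valley, doubleAscent, doubleDescent, peak, card_filter_Icc_one, Nat.add_sub_cancel, gt_iff_lt,
    add_assoc, one_add_one_eq_two, hgt]
  ring

theorem sum_perm_eq_sum_motzkinCoeff (hn : 1 ≤ n) (p q x y z w : R) {K : ℕ} (hK : n ≤ 2 * K) :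
    ∑ σ : Equiv.Perm (Fin n), p ^ res σ * q ^ les σ * x ^ valley 0 σ * y ^ doubleAscent 0 σ *
      z ^ doubleDescent 0 σ * w ^ peak 0 σ =
    ∑ k ∈ range K,
      motzkinCoeff (pqNat p q) n 1 k * x ^ k * (y + z) ^ (n - 1 - 2 * k) * w ^ (k + 1) := by
  have h := barredSum_eq_motzkinSum p q
    (fun a b => bif a then bif b then w else y else bif b then z else x) n 1
  rw [motzkinSum_eq_sum (K := K) _ _ _ _ (by omega)] at h
  simpa only [barredSum, bars_one hn, sum_singleton, barredWeight_endBars, cond_true, cond_false]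
    using h

open Polynomial in
theorem sum_perm_valley_eq (hn : 1 ≤ n) (p q y z : R) (k : ℕ) :
    ∑ σ : Equiv.Perm (Fin n) with valley 0 σ = k,
      p ^ res σ * q ^ les σ * y ^ doubleAscent 0 σ * z ^ doubleDescent 0 σ =
    motzkinCoeff (pqNat p q) n 1 k * (y + z) ^ (n - 1 - 2 * k) := by
  have hleft : ∀ σ : Equiv.Perm (Fin n), (C p ^ res σ * C q ^ les σ * X ^ valley 0 σ *
      C y ^ doubleAscent 0 σ * C z ^ doubleDescent 0 σ * 1 ^ peak 0 σ).coeff k =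
      if valley 0 σ = k then
        p ^ res σ * q ^ les σ * y ^ doubleAscent 0 σ * z ^ doubleDescent 0 σ else 0 := fun σ => by
    rw [one_pow, mul_one, mul_right_comm _ (X ^ _), mul_right_comm _ (X ^ _)]
    simp only [← C_pow, ← C_mul, coeff_C_mul_X_pow, eq_comm]
  have hright : ∀ r : ℕ, (motzkinCoeff (pqNat (C p) (C q)) n 1 r * X ^ r *
      (C y + C z) ^ (n - 1 - 2 * r) * 1 ^ (r + 1)).coeff k = if r = k then
        motzkinCoeff (pqNat p q) n 1 r * (y + z) ^ (n - 1 - 2 * r) else 0 := fun r => by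
    have hC : motzkinCoeff (pqNat (C p) (C q)) n 1 r = C (motzkinCoeff (pqNat p q) n 1 r) := by
      simp only [map_motzkinCoeff, map_pqNat]
    rw [one_pow, mul_one, mul_right_comm, hC]
    simp only [← C_add, ← C_pow, ← C_mul, coeff_C_mul_X_pow, eq_comm]
  have h := congrArg (coeff · k) (sum_perm_eq_sum_motzkinCoeff hn (C p) (C q) X (C y) (C z) 1
    (K := n + k + 1) (by omega))
  simp only [finsetSum_coeff, hleft, hright] at h
  rw [sum_filter, h, sum_ite_eq', if_pos (mem_range.2 (by omega))]

open MvPolynomial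

theorem gammaCoeff_eq_motzkinCoeff (hn : 1 ≤ n) (k : ℕ) :
    gammaCoeff n k = motzkinCoeff (pqNat (X 0) (X 1)) n 1 k := by
  have h := sum_perm_valley_eq hn (X 0 : MvPolynomial (Fin 2) ℤ)
    (X 1) 1 0 k
  rw [add_zero, one_pow, mul_one] at h
  rw [← h, gammaCoeff, permsValley, ← filter_filter, sum_filter (doubleDescent 0 · = 0)]
  simp only [one_pow, mul_one, zero_pow_eq, mul_ite, mul_zero]

theorem add_pow_dvd_gammaCoeff (hn : 1 ≤ n) (k : ℕ) :
    (X 0 + X 1) ^ k ∣ gammaCoeff n k :=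
  gammaCoeff_eq_motzkinCoeff hn k ▸
    pow_dvd_motzkinCoeff (fun _ => add_dvd_pqNat_of_even _ _) n 1 k

theorem inclPQ_gammaCoeff (hn : 1 ≤ n) (k : ℕ) :
    inclPQ (gammaCoeff n k) =
      motzkinCoeff (pqNat (X 0) (X 1)) n 1 k := by
  rw [gammaCoeff_eq_motzkinCoeff hn, ← RingHom.coe_coe, map_motzkinCoeff]
  simp [map_pqNat, inclPQ]

theorem genEulerian_eq (hn : 1 ≤ n) :
    genEulerian n = ∑ k ∈ range ((n - 1) / 2 + 1), inclPQ (gammaCoeff n k) *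
      (X 2 * X 5) ^ k *
      (X 3 + X 4 * X 2) ^ (n - 1 - 2 * k) := by
  have h := sum_perm_eq_sum_motzkinCoeff hn (X 0 : MvPolynomial (Fin 6) ℤ)
    (X 1) (X 2 * X 5) (X 3)
    (X 4 * X 2) 1 (K := (n - 1) / 2 + 1) (by omega)
  simp only [one_pow, mul_one, ← inclPQ_gammaCoeff hn] at h
  rw [← h, genEulerian]
  refine sum_congr rfl fun σ _ => ?_
  rw [des_eq]
  ring

/-- The complement `i ↦ n + 1 - σ(i)` of a permutation, which turns the patterns 31-2 and 2-13 into
13-2 and 2-31. -/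
def complement (σ : Equiv.Perm (Fin n)) : Equiv.Perm (Fin n) := σ.trans Fin.revPerm

theorem complement_complement (σ : Equiv.Perm (Fin n)) : complement (complement σ) = σ := by
  ext i; simp [complement]

theorem word_complement (σ : Equiv.Perm (Fin n)) (i : ℕ) :
    word 0 (complement σ) i + word (n + 1) σ i = n + 1 := by
  unfold word
  split_ifs with h
  · simp only [complement, Equiv.trans_apply, Fin.revPerm_apply, Fin.val_rev]
    omega
  · exact zero_add _

theorem word_complement_inside (σ : Equiv.Perm (Fin n)) {i : ℕ} (h1 : 1 ≤ i) (h2 : i ≤ n) :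
    word 0 (complement σ) i + word 0 σ i = n + 1 := by
  rw [word_eq 0 σ h1 h2, ← word_eq (n + 1) σ h1 h2, word_complement]

theorem valley_complement (σ : Equiv.Perm (Fin n)) : valley 0 (complement σ) = peak (n + 1) σ := by
  refine congrArg card (filter_congr fun i _ => ?_)
  have h1 := word_complement σ (i - 1)
  have h2 := word_complement σ i
  have h3 := word_complement σ (i + 1)
  omega

theorem les_complement (σ : Equiv.Perm (Fin n)) : les (complement σ) = pat13_2 σ := by
  refine congrArg card (filter_congr fun x _ => ?_)
  refine and_congr_right fun h1 => and_congr_right fun h2 => and_congr_right fun h3 => ?_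
  have hpred := word_complement_inside σ (i := x.1 - 1) (by omega) (by omega)
  have hfst := word_complement_inside σ (i := x.1) (by omega) (by omega)
  have hsnd := word_complement_inside σ (i := x.2) (by omega) (by omega)
  omega

theorem res_complement (σ : Equiv.Perm (Fin n)) : res (complement σ) = pat2_31 σ := by
  refine congrArg card (filter_congr fun x _ => ?_)
  refine and_congr_right fun h1 => and_congr_right fun h2 => and_congr_right fun h3 => ?_
  have hfst := word_complement_inside σ (i := x.1) (by omega) (by omega)
  have hsnd := word_complement_inside σ (i := x.2) (by omega) (by omega)
  have hsucc := word_complement_inside σ (i := x.2 + 1) (by omega) (by omega)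
  omega

theorem peakSum_eq (n k : ℕ) :
    peakSum n k = ∑ σ : Equiv.Perm (Fin n) with valley 0 σ = k,
      X 0 ^ les σ * X 1 ^ res σ := by
  refine sum_nbij' complement complement (fun σ hσ => ?_) (fun σ hσ => ?_)
    (fun σ _ => complement_complement σ) (fun σ _ => complement_complement σ) fun σ _ => ?_
  · simpa [valley_complement] using hσ
  · simpa [← valley_complement, complement_complement] using hσ
  · rw [les_complement, res_complement]

theorem two_pow_mul_gammaCoeff (hn : 1 ≤ n) (k : ℕ) :
    2 ^ (n - 1 - 2 * k) * gammaCoeff n k = peakSum n k := by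
  have h := sum_perm_valley_eq hn (X 1 : MvPolynomial (Fin 2) ℤ)
    (X 0) 1 1 k
  simp only [one_pow, mul_one, one_add_one_eq_two] at h
  rw [gammaCoeff_eq_motzkinCoeff hn, mul_comm, funext (pqNat_comm _ _), ← h, peakSum_eq]
  exact sum_congr rfl fun σ _ => mul_comm _ _

end Statistics

end PermStat

theorem mainTheorem1 (n : ℕ) (hn : 1 ≤ n) :
    -- the expansion in `ℤ[p,q,t,u,v,w]`, with `p, q, t, u, v, w = X 0, …, X 5`
    (PermStat.genEulerian n =
      ∑ k ∈ Finset.range ((n - 1) / 2 + 1),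
        PermStat.inclPQ (PermStat.gammaCoeff n k) *
          (MvPolynomial.X 2 * MvPolynomial.X 5) ^ k *
          (MvPolynomial.X 3 + MvPolynomial.X 4 * MvPolynomial.X 2) ^ (n - 1 - 2 * k)) ∧
    -- the divisibility in `ℤ[p,q]`
    (∀ k : ℕ, k ≤ (n - 1) / 2 →
      ((MvPolynomial.X 0 + MvPolynomial.X 1) ^ k : MvPolynomial (Fin 2) ℤ) ∣
        PermStat.gammaCoeff n k) ∧
    -- the polynomials in Brändén's conjecture are the `a_{n,k}(p,q)`
    (∀ k : ℕ, k ≤ (n - 1) / 2 →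
      (2 : MvPolynomial (Fin 2) ℤ) ^ (n - 1 - 2 * k) * PermStat.gammaCoeff n k =
        PermStat.peakSum n k) := by
  exact ⟨PermStat.genEulerian_eq hn, fun k _ => PermStat.add_pow_dvd_gammaCoeff hn k,
    fun k _ => PermStat.two_pow_mul_gammaCoeff hn k⟩
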